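/- A subset $S$ of a preordered set $(\Lambda,\lesssim)$ is *convex* if $i\lesssim k\lesssim j$ with $i,j\in S$ implies $k\in S$, and *strongly convex* if every $i\in\Lambda\setminus S$ is either strictly below every element of $S$ or strictly above every element of $S$ (where $i$ is strictly below $j$ if $i\lesssim j$ and $j\not\lesssim i$). The preordered set $\Lambda$ is *$\mathbb{Z}$-like* if every finite subset is contained in a finite strongly convex subset. Let $\Lambda$ be a $\mathbb{Z}$-like preordered set and $F$ a field. A matrix $(a_{ij})_{i,j\in\Lambda}$ over $F$ is *nonsingular* if there is a finite convex $S\subseteq\Lambda$ such that $(a_{ij})_{i,j\in T}$ is invertible for every finite convex $T\supseteq S$; *upper triangular* if $a_{ij}=0$ whenever $i\not\lesssim j$; *almost upper triangular* if $a_{ij}\neq 0$ for only finitely many pairs $(i,j)$ with $i\not\lesssim j$; and *scalar* if $a_{ij}=0$ for $i\neq j$ and $a_{ii}$ does not depend on $i$. Let $\mathrm{U}_\Lambda(F)$ be the set of nonsingular upper triangular matrices, $\mathrm{AU}_\Lambda(F)$ the group, under matrix multiplication, of nonsingular almost upper triangular matrices, and $\mathrm{Z}_\Lambda(F)$ its subgroup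 of scalar matrices. For a finite convex $S\subseteq\Lambda$ let $\Lambda+S$ be the set $\Lambda$ with the preorder generated by $\lesssim$ and by declaring all elements of $S$ equivalent; then $\mathrm{U}_{\Lambda+S}(F)\subseteq\mathrm{AU}_\Lambda(F)$. For $F$ discrete, give $\mathrm{U}_{\Lambda+S}(F)$ the topology of entrywise convergence (the subspace topology of the product topology on $F^{\Lambda\times\Lambda}$) and $\mathrm{AU}_\Lambda(F)$ the direct limit topology: a subset is open if and only if its intersection with $\mathrm{U}_{\Lambda+S}(F)$ is open in $\mathrm{U}_{\Lambda+S}(F)$ for every finite convex $S$. **Theorem.** Let $F$ be a finite discrete field and let $\Lambda$ be an infinite $\mathbb{Z}$-like preordered set. Then $\mathrm{AU}_\Lambda(F)$ is a totally disconnected, locally compact topological group, and $\mathrm{Z}_\Lambda(F)$ is its unique largest proper closed normal subgroup; that is, $\mathrm{Z}_\Lambda(F)$ is a proper closed normal subgroup that contains every proper closed normal subgroup. In particular, $\mathrm{AU}_\Lambda(F)/\mathrm{Z}_\Lambda(F)$, with the quotient topology, is topologically simple: it is nontrivial and has no closed normal subgroups other than the trivial subgroup and the whole group. -/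

import Mathlib

/-- A subset `S` of a preordered set is strongly convex if every element outside `S` is either
strictly below all elements of `S` or strictly above all elements of `S`. -/
def StronglyConvex {Λ : Type*} [Preorder Λ] (S : Set Λ) : Prop :=
  ∀ i, i ∉ S → (∀ j ∈ S, i < j) ∨ (∀ j ∈ S, j < i)

/-- A preordered set is `ℤ`-like if every finite subset is contained in a finite strongly
convex subset. -/
class ZLike (Λ : Type*) [Preorder Λ] : Prop where
  exists_stronglyConvex : ∀ S : Finset Λ, ∃ T : Finset Λ, S ⊆ T ∧ StronglyConvex (T : Set Λ)

/-- The preorder `Λ + S` on `Λ` generated by the given preorder and by declaring all elements of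
`S` equivalent; see `adjoin_le_iff_reflTransGen`. -/
@[reducible] def adjoin {Λ : Type*} [Preorder Λ] (S : Finset Λ) : Preorder Λ where
  le i j := i ≤ j ∨ ∃ p ∈ S, ∃ q ∈ S, i ≤ p ∧ q ≤ j
  lt i j := (i ≤ j ∨ ∃ p ∈ S, ∃ q ∈ S, i ≤ p ∧ q ≤ j) ∧
    ¬ (j ≤ i ∨ ∃ p ∈ S, ∃ q ∈ S, j ≤ p ∧ q ≤ i)
  le_refl i := Or.inl le_rfl
  le_trans := by
    rintro i j k (h | ⟨p, hp, q, hq, h1, h2⟩) (h' | ⟨p', hp', q', hq', h1', h2'⟩)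
    · exact Or.inl (h.trans h')
    · exact Or.inr ⟨p', hp', q', hq', h.trans h1', h2'⟩
    · exact Or.inr ⟨p, hp, q, hq, h1, h2.trans h'⟩
    · exact Or.inr ⟨p, hp, q', hq', h1, h2'⟩

theorem adjoin_le_iff_reflTransGen {Λ : Type*} [Preorder Λ] (S : Finset Λ) (i j : Λ) :
    (adjoin S).le i j ↔ Relation.ReflTransGen (fun x y => x ≤ y ∨ (x ∈ S ∧ y ∈ S)) i j := by
  constructor
  · rintro (h | ⟨p, hp, q, hq, h1, h2⟩)
    · exact .single (Or.inl h)
    · exact Relation.ReflTransGen.head (b := p) (Or.inl h1)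
        (Relation.ReflTransGen.head (b := q) (Or.inr ⟨hp, hq⟩) (.single (Or.inl h2)))
  · intro h
    induction h with
    | refl => exact (adjoin S).le_refl i
    | tail _ h ih =>
      refine (adjoin S).le_trans _ _ _ ih ?_
      rcases h with h | ⟨h1, h2⟩
      · exact Or.inl h
      · exact Or.inr ⟨_, h1, _, h2, le_rfl, le_rfl⟩

section Matrices

open scoped Classical

variable {Λ R : Type*} [Preorder Λ] [CommRing R]

/-- The submatrix of `a` with rows and columns in the finite set `T`. -/
def block (a : Matrix Λ Λ R) (T : Finset Λ) : Matrix T T R :=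
  a.submatrix Subtype.val Subtype.val

/-- The matrix `a` is nonsingular if there is a finite convex set `S` such that, for every finite
convex `T ⊇ S`, the `T × T` submatrix of `a` is invertible. -/
def Nonsingular (a : Matrix Λ Λ R) : Prop :=
  ∃ S : Finset Λ, (S : Set Λ).OrdConnected ∧
    ∀ T : Finset Λ, (T : Set Λ).OrdConnected → S ⊆ T → IsUnit (block a T)

/-- Upper triangular matrices. -/
def IsUpper (a : Matrix Λ Λ R) : Prop := ∀ i j, ¬ i ≤ j → a i j = 0

/-- Almost upper triangular matrices. -/
def IsAlmostUpper (a : Matrix Λ Λ R) : Prop :=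
  {p : Λ × Λ | ¬ p.1 ≤ p.2 ∧ a p.1 p.2 ≠ 0}.Finite

/-- Scalar matrices. -/
def IsScalarMatrix {Λ R : Type*} [Zero R] (a : Matrix Λ Λ R) : Prop :=
  (∀ i j, i ≠ j → a i j = 0) ∧ ∀ i j, a i i = a j j

/-- The product of matrices with possibly infinite index set. For the matrices in `AU` below all
the sums have only finitely many nonzero terms: see `AU.finite_support_mul`. -/
noncomputable def mulM {Λ R : Type*} [CommRing R] (a b : Matrix Λ Λ R) : Matrix Λ Λ R :=
  fun i j => ∑ᶠ k, a i k * b k j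

variable (Λ R) in
/-- The set `U_Λ(R)` of nonsingular upper triangular matrices. -/
def UT : Set (Matrix Λ Λ R) := {a | Nonsingular a ∧ IsUpper a}

variable (Λ R) in
/-- The type `AU_Λ(R)` of nonsingular almost upper triangular matrices. -/
def AU : Type _ := {a : Matrix Λ Λ R // Nonsingular a ∧ IsAlmostUpper a}

theorem exists_convex [ZLike Λ] (S : Finset Λ) :
    ∃ T : Finset Λ, S ⊆ T ∧ (T : Set Λ).OrdConnected := by
  obtain ⟨T, hST, hT⟩ := ZLike.exists_stronglyConvex S
  refine ⟨T, hST, ⟨fun i hi j hj k hk => ?_⟩⟩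
  by_contra hkT
  rcases hT k hkT with h | h
  · exact (h i hi).not_ge hk.1
  · exact (h j hj).not_ge hk.2

theorem support_subset_of_upper {a b : Matrix Λ Λ R} (ha : IsUpper a) (hb : IsUpper b)
    {T : Finset Λ} (hT : (T : Set Λ).OrdConnected) {i j : Λ} (hi : i ∈ T) (hj : j ∈ T) :
    (Function.support fun k => a i k * b k j) ⊆ (T : Set Λ) := by
  intro k hk
  have h1 : i ≤ k := by
    by_contra h
    exact hk (by simp [ha i k h])
  have h2 : k ≤ j := by
    by_contra h
    exact hk (by simp [hb k j h])
  exact hT.out hi hj ⟨h1, h2⟩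

theorem mulM_apply {a b : Matrix Λ Λ R} (ha : IsUpper a) (hb : IsUpper b)
    {T : Finset Λ} (hT : (T : Set Λ).OrdConnected) {i j : Λ} (hi : i ∈ T) (hj : j ∈ T) :
    mulM a b i j = ∑ k ∈ T, a i k * b k j :=
  finsum_eq_sum_of_support_subset _ (support_subset_of_upper ha hb hT hi hj)

theorem IsUpper.mulM {a b : Matrix Λ Λ R} (ha : IsUpper a) (hb : IsUpper b) :
    IsUpper (mulM a b) := by
  intro i j hij
  refine (finsum_congr fun k => ?_).trans finsum_zero
  by_cases h : i ≤ k
  · rw [hb k j fun h' => hij (h.trans h'), mul_zero]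
  · rw [ha i k h, zero_mul]

theorem block_mulM {a b : Matrix Λ Λ R} (ha : IsUpper a) (hb : IsUpper b)
    {T : Finset Λ} (hT : (T : Set Λ).OrdConnected) :
    block (mulM a b) T = block a T * block b T := by
  ext i j
  simp only [block, Matrix.submatrix_apply, Matrix.mul_apply]
  rw [mulM_apply ha hb hT i.2 j.2, ← Finset.sum_coe_sort]

theorem ext_of_block [ZLike Λ] {a b : Matrix Λ Λ R} (S : Finset Λ)
    (h : ∀ T : Finset Λ, (T : Set Λ).OrdConnected → S ⊆ T → block a T = block b T) : a = b := by
  ext i j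
  obtain ⟨T, hT, hc⟩ := exists_convex (S ∪ {i, j})
  have := congrFun (congrFun (h T hc fun x hx => hT (by simp [hx]))
    ⟨i, hT (by simp)⟩) ⟨j, hT (by simp)⟩
  simpa [block] using this

theorem block_one (T : Finset Λ) : block (1 : Matrix Λ Λ R) T = 1 := by
  ext i j
  by_cases h : i = j
  · subst h
    simp [block]
  · rw [Matrix.one_apply_ne h]
    exact Matrix.one_apply_ne fun h' => h (Subtype.ext h')

theorem isUpper_one : IsUpper (1 : Matrix Λ Λ R) := by
  intro i j h
  rw [Matrix.one_apply_ne]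
  rintro rfl
  exact h le_rfl

theorem one_mem_UT : (1 : Matrix Λ Λ R) ∈ UT Λ R :=
  ⟨⟨∅, by simpa using Set.ordConnected_empty, fun T _ _ => by rw [block_one]; exact isUnit_one⟩,
    isUpper_one⟩

theorem mulM_mem_UT [ZLike Λ] {a b : Matrix Λ Λ R} (ha : a ∈ UT Λ R) (hb : b ∈ UT Λ R) :
    mulM a b ∈ UT Λ R := by
  obtain ⟨⟨S, -, hS⟩, ha⟩ := ha
  obtain ⟨⟨S', -, hS'⟩, hb⟩ := hb
  obtain ⟨T, hT, hc⟩ := exists_convex (S ∪ S')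
  refine ⟨⟨T, hc, fun T' hc' hT' => ?_⟩, ha.mulM hb⟩
  rw [block_mulM ha hb hc']
  exact (hS T' hc' ((Finset.subset_union_left.trans hT).trans hT')).mul
    (hS' T' hc' ((Finset.subset_union_right.trans hT).trans hT'))

theorem mulM_assoc_UT [ZLike Λ] {a b c : Matrix Λ Λ R} (ha : a ∈ UT Λ R) (hb : b ∈ UT Λ R)
    (hc : c ∈ UT Λ R) : mulM (mulM a b) c = mulM a (mulM b c) := by
  refine ext_of_block ∅ fun T hT _ => ?_
  rw [block_mulM (ha.2.mulM hb.2) hc.2 hT, block_mulM ha.2 hb.2 hT,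
    block_mulM ha.2 (hb.2.mulM hc.2) hT, block_mulM hb.2 hc.2 hT, Matrix.mul_assoc]

theorem one_mulM_UT [ZLike Λ] {a : Matrix Λ Λ R} (ha : a ∈ UT Λ R) : mulM 1 a = a := by
  refine ext_of_block ∅ fun T hT _ => ?_
  rw [block_mulM isUpper_one ha.2 hT, block_one, Matrix.one_mul]

theorem inv_block_upper {a : Matrix Λ Λ R} (ha : IsUpper a) {T : Finset Λ}
    (hu : IsUnit (block a T)) (i j : T) (hij : ¬ (i : Λ) ≤ j) : (block a T)⁻¹ i j = 0 := by
  have : Invertible (block a T) := hu.invertible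
  have hb : (block a T).BlockTriangular (fun k : T => if (i : Λ) ≤ k then (1 : ℕ) else 0) := by
    intro k l hkl
    by_cases hk : (i : Λ) ≤ k
    · by_cases hl : (i : Λ) ≤ l
      · simp [hk, hl] at hkl
      · exact ha k l fun h => hl (hk.trans h)
    · simp [hk] at hkl
  exact Matrix.blockTriangular_inv_of_blockTriangular hb (by simp [hij])

/-- Extension by zero of a finite block. -/
noncomputable def extM {Λ R : Type*} [Zero R] {T : Finset Λ} (m : Matrix T T R) : Matrix Λ Λ R :=
  fun i j => if h : i ∈ T ∧ j ∈ T then m ⟨i, h.1⟩ ⟨j, h.2⟩ else 0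

theorem block_extM {Λ R : Type*} [CommRing R] {T : Finset Λ} (m : Matrix T T R) : block (extM m) T = m := by
  ext i j
  simp [block, extM]

theorem exists_inv_UT [ZLike Λ] {a : Matrix Λ Λ R} (ha : a ∈ UT Λ R) :
    ∃ b ∈ UT Λ R, mulM b a = 1 := by
  obtain ⟨⟨S, hSc, hS⟩, ha⟩ := ha
  have key : ∀ T T' : Finset Λ, (T : Set Λ).OrdConnected → (T' : Set Λ).OrdConnected → S ⊆ T →
      T ⊆ T' → block (extM (block a T')⁻¹) T = (block a T)⁻¹ := by
    intro T T' hT hT' hST hTT'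
    have hu := hS T' hT' (hST.trans hTT')
    have hU : IsUpper (extM (block a T')⁻¹) := by
      intro i j hij
      by_cases h : i ∈ T' ∧ j ∈ T'
      · simp only [extM, h, and_self, dite_true]
        exact inv_block_upper ha hu ⟨i, h.1⟩ ⟨j, h.2⟩ hij
      · simp [extM, h]
    have h1 : block (mulM a (extM (block a T')⁻¹)) T' = 1 := by
      rw [block_mulM ha hU hT', block_extM]
      exact Matrix.mul_nonsing_inv _ ((Matrix.isUnit_iff_isUnit_det _).1 hu)
    refine (Matrix.inv_eq_right_inv ?_).symm
    rw [← block_mulM ha hU hT]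
    ext i j
    have := congrFun (congrFun h1 ⟨i, hTT' i.2⟩) ⟨j, hTT' j.2⟩
    rw [← block_one] at this ⊢
    exact this
  choose! H hH hHc using fun F : Finset Λ => exists_convex F
  let b : Matrix Λ Λ R := fun i j => extM (block a (H (S ∪ {i, j})))⁻¹ i j
  have hb : ∀ T : Finset Λ, (T : Set Λ).OrdConnected → S ⊆ T → block b T = (block a T)⁻¹ := by
    intro T hT hST
    ext i j
    have hT1 := hH (T ∪ H (S ∪ {i.1, j.1}))
    have e1 := key T _ hT (hHc _) hST (Finset.subset_union_left.trans hT1)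
    have e2 := key (H (S ∪ {i.1, j.1})) _ (hHc _) (hHc _)
      (Finset.subset_union_left.trans (hH _)) (Finset.subset_union_right.trans hT1)
    have hi : i.1 ∈ H (S ∪ {i.1, j.1}) := hH _ (by simp)
    have hj : j.1 ∈ H (S ∪ {i.1, j.1}) := hH _ (by simp)
    have e2' := congrFun (congrFun e2 ⟨i, hi⟩) ⟨j, hj⟩
    have e1' := congrFun (congrFun e1 i) j
    rw [← e1']
    simp only [block, Matrix.submatrix_apply] at e2' ⊢
    rw [e2']
    change extM (block a (H (S ∪ {i.1, j.1})))⁻¹ i.1 j.1 = _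
    rw [extM, dif_pos ⟨hi, hj⟩]
    rfl
  have hbU : IsUpper b := by
    intro i j hij
    obtain ⟨T, hT, hc⟩ := exists_convex (S ∪ {i, j})
    have hST := Finset.subset_union_left.trans hT
    have hi : i ∈ T := hT (by simp)
    have hj : j ∈ T := hT (by simp)
    have := congrFun (congrFun (hb T hc hST) ⟨i, hi⟩) ⟨j, hj⟩
    rw [inv_block_upper ha (hS T hc hST) _ _ hij] at this
    exact this
  refine ⟨b, ⟨⟨S, hSc, fun T hT hST => ?_⟩, hbU⟩, ext_of_block S fun T hT hST => ?_⟩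
  · rw [hb T hT hST]
    exact (Matrix.isUnit_nonsing_inv_iff).2 (hS T hT hST)
  · rw [block_mulM hbU ha hT, hb T hT hST, block_one]
    exact Matrix.nonsing_inv_mul _ ((Matrix.isUnit_iff_isUnit_det _).1 (hS T hT hST))

theorem zLike_adjoin [ZLike Λ] (S : Finset Λ) : @ZLike Λ (adjoin S) := by
  refine @ZLike.mk Λ (adjoin S) fun F => ?_
  obtain ⟨T, hT, hs⟩ := ZLike.exists_stronglyConvex (S ∪ F)
  have hST : ∀ p ∈ S, p ∈ T := fun p hp => hT (by simp [hp])
  refine ⟨T, Finset.subset_union_right.trans hT, fun k hk => ?_⟩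
  rcases hs k hk with h | h
  · refine Or.inl fun j hj => ((adjoin S).lt_iff_le_not_ge k j).2 ⟨Or.inl (h j hj).le, ?_⟩
    rintro (h' | ⟨p, hp, q, hq, h1, h2⟩)
    · exact (h j hj).not_ge h'
    · exact (h q (hST q hq)).not_ge h2
  · refine Or.inr fun j hj => ((adjoin S).lt_iff_le_not_ge j k).2 ⟨Or.inl (h j hj).le, ?_⟩
    rintro (h' | ⟨p, hp, q, hq, h1, h2⟩)
    · exact (h j hj).not_ge h'
    · exact (h p (hST p hp)).not_ge h1

theorem ordConnected_of_adjoin {S T : Finset Λ} (h : @Set.OrdConnected Λ (adjoin S) (T : Set Λ)) :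
    (T : Set Λ).OrdConnected :=
  ⟨fun _ hi _ hj _ hk => (@Set.OrdConnected.out Λ (adjoin S) _ h) hi hj
    ⟨Or.inl hk.1, Or.inl hk.2⟩⟩

theorem ordConnected_adjoin {S T : Finset Λ} (hST : S ⊆ T) (h : (T : Set Λ).OrdConnected) :
    @Set.OrdConnected Λ (adjoin S) (T : Set Λ) := by
  refine @Set.OrdConnected.mk Λ (adjoin S) _ ?_
  rintro i hi j hj k ⟨h1 | ⟨p, hp, q, hq, h1, h2⟩, h1' | ⟨p', hp', q', hq', h1', h2'⟩⟩
  · exact h.out hi hj ⟨h1, h1'⟩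
  · exact h.out hi (hST hp') ⟨h1, h1'⟩
  · exact h.out (hST hq) hj ⟨h2, h1'⟩
  · exact h.out (hST hq) (hST hp') ⟨h2, h1'⟩

/-- `U_{Λ+S}(R) ⊆ AU_Λ(R)`. -/
theorem mem_AU_of_mem_UT_adjoin [ZLike Λ] {S : Finset Λ} {a : Matrix Λ Λ R}
    (ha : a ∈ @UT Λ R (adjoin S) _) : Nonsingular a ∧ IsAlmostUpper a := by
  obtain ⟨⟨S₀, -, hS₀⟩, ha⟩ := ha
  constructor
  · obtain ⟨T, hT, hc⟩ := exists_convex (S ∪ S₀)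
    refine ⟨T, hc, fun T' hc' hT' => hS₀ T' (ordConnected_adjoin ?_ hc') ?_⟩
    · exact (Finset.subset_union_left.trans hT).trans hT'
    · exact (Finset.subset_union_right.trans hT).trans hT'
  · obtain ⟨T, hT, hs⟩ := ZLike.exists_stronglyConvex S
    refine (T ×ˢ T).finite_toSet.subset ?_
    rintro ⟨i, j⟩ ⟨hij, h0⟩
    have hle : (adjoin S).le i j := by
      by_contra h
      exact h0 (ha i j h)
    rcases hle with h | ⟨p, hp, q, hq, h1, h2⟩
    · exact absurd h hij
    · simp only [Finset.coe_product, Set.mem_prod, Finset.mem_coe]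
      constructor
      · by_contra hi
        rcases hs i hi with h | h
        · exact hij ((h q (hT hq)).le.trans h2)
        · exact (h p (hT hp)).not_ge h1
      · by_contra hj
        rcases hs j hj with h | h
        · exact (h q (hT hq)).not_ge h2
        · exact hij (h1.trans (h p (hT hp)).le)

/-- Every matrix in `AU_Λ(R)` lies in `U_{Λ+S}(R)` for all large `S`. -/
theorem exists_mem_UT_adjoin [ZLike Λ] {a : Matrix Λ Λ R} (h : Nonsingular a ∧ IsAlmostUpper a) :
    ∃ S₀ : Finset Λ, ∀ S, S₀ ⊆ S → a ∈ @UT Λ R (adjoin S) _ := by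
  obtain ⟨⟨S₁, -, hS₁⟩, hf⟩ := h
  rw [IsAlmostUpper] at hf
  refine ⟨hf.toFinset.image Prod.fst ∪ hf.toFinset.image Prod.snd, fun S hS => ⟨?_, ?_⟩⟩
  · obtain ⟨T, hT, hc⟩ := @exists_convex Λ (adjoin S) (zLike_adjoin S) S₁
    exact ⟨T, hc, fun T' hc' hT' => hS₁ T' (ordConnected_of_adjoin hc') (hT.trans hT')⟩
  · intro i j hij
    by_contra h0
    have hm : (i, j) ∈ hf.toFinset :=
      (Set.Finite.mem_toFinset hf).2 ⟨fun h => hij (Or.inl h), h0⟩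
    refine hij (Or.inr ⟨i, hS ?_, j, hS ?_, le_rfl, le_rfl⟩)
    · exact Finset.mem_union_left _ (Finset.mem_image_of_mem Prod.fst hm)
    · exact Finset.mem_union_right _ (Finset.mem_image_of_mem Prod.snd hm)

namespace AU

theorem finite_support_mul [ZLike Λ] (a b : AU Λ R) (i j : Λ) :
    (Function.support fun k => a.1 i k * b.1 k j).Finite := by
  obtain ⟨S, hS⟩ := exists_mem_UT_adjoin a.2
  obtain ⟨S', hS'⟩ := exists_mem_UT_adjoin b.2
  have ha := hS _ (Finset.subset_union_left (s₂ := S'))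
  have hb := hS' _ (Finset.subset_union_right (s₁ := S))
  obtain ⟨T, hT, hc⟩ := @exists_convex Λ (adjoin (S ∪ S')) (zLike_adjoin _) {i, j}
  exact T.finite_toSet.subset (@support_subset_of_upper Λ R (adjoin (S ∪ S')) _ _ _ ha.2 hb.2 _ hc
    _ _ (hT (by simp)) (hT (by simp)))

theorem mulM_mem [ZLike Λ] (a b : AU Λ R) :
    Nonsingular (mulM a.1 b.1) ∧ IsAlmostUpper (mulM a.1 b.1) := by
  obtain ⟨S, hS⟩ := exists_mem_UT_adjoin a.2
  obtain ⟨S', hS'⟩ := exists_mem_UT_adjoin b.2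
  exact mem_AU_of_mem_UT_adjoin (@mulM_mem_UT Λ R (adjoin (S ∪ S')) _ (zLike_adjoin _) _ _
    (hS _ Finset.subset_union_left) (hS' _ Finset.subset_union_right))

theorem exists_inv [ZLike Λ] (a : AU Λ R) : ∃ b : AU Λ R, mulM b.1 a.1 = 1 := by
  obtain ⟨S, hS⟩ := exists_mem_UT_adjoin a.2
  obtain ⟨b, hb, h⟩ := @exists_inv_UT Λ R (adjoin S) _ (zLike_adjoin _) _ (hS S subset_rfl)
  exact ⟨⟨b, mem_AU_of_mem_UT_adjoin hb⟩, h⟩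

noncomputable instance [ZLike Λ] : Mul (AU Λ R) := ⟨fun a b => ⟨mulM a.1 b.1, mulM_mem a b⟩⟩

noncomputable instance [ZLike Λ] : One (AU Λ R) :=
  ⟨⟨1, mem_AU_of_mem_UT_adjoin (@one_mem_UT Λ R (adjoin ∅) _)⟩⟩

noncomputable instance [ZLike Λ] : Inv (AU Λ R) := ⟨fun a => (exists_inv a).choose⟩

theorem mul_val [ZLike Λ] (a b : AU Λ R) : (a * b).1 = mulM a.1 b.1 := rfl

theorem one_val [ZLike Λ] : (1 : AU Λ R).1 = 1 := rfl

/-- `AU_Λ(R)` is a group under matrix multiplication. -/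
noncomputable instance [ZLike Λ] : Group (AU Λ R) :=
  Group.ofLeftAxioms
    (by
      intro a b c
      obtain ⟨S, hS⟩ := exists_mem_UT_adjoin a.2
      obtain ⟨S', hS'⟩ := exists_mem_UT_adjoin b.2
      obtain ⟨S'', hS''⟩ := exists_mem_UT_adjoin c.2
      exact Subtype.ext (@mulM_assoc_UT Λ R (adjoin (S ∪ S' ∪ S'')) _ (zLike_adjoin _) _ _ _
        (hS _ (Finset.subset_union_left.trans Finset.subset_union_left))
        (hS' _ (Finset.subset_union_right.trans Finset.subset_union_left))
        (hS'' _ Finset.subset_union_right)))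
    (by
      intro a
      obtain ⟨S, hS⟩ := exists_mem_UT_adjoin a.2
      exact Subtype.ext (@one_mulM_UT Λ R (adjoin S) _ (zLike_adjoin _) _ (hS _ subset_rfl)))
    (fun a => Subtype.ext (exists_inv a).choose_spec)

/-- The inclusion `U_{Λ+S}(R) → AU_Λ(R)`. -/
def ofUT [ZLike Λ] (S : Finset Λ) (u : @UT Λ R (adjoin S) _) : AU Λ R :=
  ⟨u.1, mem_AU_of_mem_UT_adjoin u.2⟩

/-- The direct limit topology on `AU_Λ(R)`: a set is open iff, for every finite convex `S`, its
intersection with `U_{Λ+S}(R)` is open in `U_{Λ+S}(R)`, where the latter carries the topology of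
entrywise convergence, that is, the subspace topology of the product topology on matrices. -/
instance [ZLike Λ] [TopologicalSpace R] : TopologicalSpace (AU Λ R) :=
  ⨆ S : {S : Finset Λ // (S : Set Λ).OrdConnected},
    TopologicalSpace.coinduced (ofUT S.1) inferInstance

end AU

theorem mulM_scalar_right {Λ R : Type*} [CommRing R] (a z : Matrix Λ Λ R) (hz : IsScalarMatrix z) (i j : Λ) :
    mulM a z i j = a i j * z j j :=
  finsum_eq_single _ j fun k hk => by rw [hz.1 k j hk, mul_zero]

theorem mulM_scalar_left {Λ R : Type*} [CommRing R] (a z : Matrix Λ Λ R) (hz : IsScalarMatrix z) (i j : Λ) :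
    mulM z a i j = z i i * a i j :=
  finsum_eq_single _ i fun k hk => by rw [hz.1 i k hk.symm, zero_mul]

variable (Λ R) in
/-- The subgroup `Z_Λ(R)` of nonsingular scalar matrices. -/
def scalarSubgroup [ZLike Λ] : Subgroup (AU Λ R) where
  carrier := {a | IsScalarMatrix a.1}
  one_mem' := by
    refine ⟨fun i j h => ?_, fun i j => ?_⟩ <;> rw [AU.one_val]
    · exact Matrix.one_apply_ne h
    · simp
  mul_mem' := by
    intro a b ha hb
    refine ⟨fun i j h => ?_, fun i j => ?_⟩ <;> rw [AU.mul_val]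
    · rw [mulM_scalar_right _ _ hb, ha.1 i j h, zero_mul]
    · rw [mulM_scalar_right _ _ hb, mulM_scalar_right _ _ hb, ha.2 i j, hb.2 i j]
  inv_mem' := by
    intro a ha
    have h : ∀ i j, (a⁻¹).1 i j * a.1 j j = (1 : Matrix Λ Λ R) i j := fun i j => by
      rw [← mulM_scalar_right _ _ ha, ← AU.mul_val, inv_mul_cancel, AU.one_val]
    have hu : ∀ j, IsUnit (a.1 j j) := fun j =>
      IsUnit.of_mul_eq_one ((a⁻¹).1 j j) (by rw [mul_comm, h j j, Matrix.one_apply_eq])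
    refine ⟨fun i j hij => (hu j).mul_left_injective ?_, fun i j => (hu j).mul_left_injective ?_⟩
    · simp only [h, zero_mul, Matrix.one_apply_ne hij]
    · have h1 := h i i
      rw [ha.2 i j] at h1
      simp only [h, h1, Matrix.one_apply_eq]

instance [ZLike Λ] : (scalarSubgroup Λ R).Normal := by
  refine ⟨fun z hz g => ?_⟩
  have : g * z = z * g := by
    apply Subtype.ext
    ext i j
    rw [AU.mul_val, AU.mul_val, mulM_scalar_right _ _ hz, mulM_scalar_left _ _ hz, hz.2 i j,
      mul_comm]
  rwa [this, mul_inv_cancel_right]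

end Matrices

/-- A topological group is topologically simple if it is nontrivial and its only closed normal
subgroups are the trivial subgroup and the whole group. -/
structure IsTopologicallySimple (G : Type*) [Group G] [TopologicalSpace G] : Prop where
  nontrivial : Nontrivial G
  eq_bot_or_eq_top : ∀ N : Subgroup G, N.Normal → IsClosed (N : Set G) → N = ⊥ ∨ N = ⊤

/-! ### Topology of `AU_Λ(R)`: open subgroups `U_{Λ+S}(R)`, their compactness and continuity of the
operations. -/

section Topology

open scoped Classical

section Preorder

variable {Λ R : Type*} [Preorder Λ] [CommRing R]

/-! Topology. For upper triangular matrices, products and inverses restrict to finite convex blocks,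
so each of their entries depends on finitely many entries of the factors. Moreover nonsingularity
then means that every finite convex block is invertible (`mem_UT_iff`). Hence each `U_{Λ+S}(F)` is
closed in `F^{Λ×Λ}`, compact when `F` is finite, and has continuous operations. Inside
`U_{Λ+S'}(F)`, membership in `U_{Λ+S}(F)` is decided by finitely many entries, so every `U_{Λ+S}(F)`
is open in `AU_Λ(F)` (`isOpenEmbedding_ofUT`), and the topological claims become local.

Normal subgroups. Let `N` be closed and normal with a nonscalar element `g`. Successive commutators
of `g` with matrices `1 + x eₖᵀ` produce a nontrivial matrix of that same shape in `N`, and then all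
elementary transvections (`single_mem_of_not_scalar`); since `Λ` is infinite, there are always fresh
indices for the commutators. Elementary transvections generate a dense subgroup
(`eq_top_of_single_mem`): the determinant is no obstruction, because the compensating entry of
`diag(x, x⁻¹)` can be pushed to infinity, where it disappears in the limit (`diag_update_mem`). So
all finite invertible blocks lie in `N`, and truncations to such blocks converge to any given
matrix. Thus `N` is everything. -/

theorem isUpper_extM_inv {a : Matrix Λ Λ R} (ha : IsUpper a) {T : Finset Λ}
    (hu : IsUnit (block a T)) : IsUpper (extM (block a T)⁻¹) := by
  intro i j hij
  by_cases h : i ∈ T ∧ j ∈ T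
  · simp only [extM, h, and_self, dite_true]
    exact inv_block_upper ha hu ⟨i, h.1⟩ ⟨j, h.2⟩ hij
  · simp [extM, h]

/-- A convex diagonal block of an invertible convex block of an upper triangular matrix is
invertible. -/
theorem isUnit_block_of_subset {a : Matrix Λ Λ R} (ha : IsUpper a) {T T' : Finset Λ}
    (hT : (T : Set Λ).OrdConnected) (hT' : (T' : Set Λ).OrdConnected) (hTT' : T ⊆ T')
    (hu : IsUnit (block a T')) : IsUnit (block a T) := by
  have hU := isUpper_extM_inv ha hu
  have h1 : block (mulM a (extM (block a T')⁻¹)) T' = 1 := by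
    rw [block_mulM ha hU hT', block_extM]
    exact Matrix.mul_nonsing_inv _ ((Matrix.isUnit_iff_isUnit_det _).1 hu)
  refine IsUnit.of_mul_eq_one (block (extM (block a T')⁻¹) T) ?_
  -- Both factors are upper triangular, so their product also restricts to the smaller convex set,
  -- where it is a block of the identity.
  rw [← block_mulM ha hU hT]
  ext i j
  have := congrFun (congrFun h1 ⟨i, hTT' i.2⟩) ⟨j, hTT' j.2⟩
  rw [← block_one] at this ⊢
  exact this

/-- Invertibility of large convex blocks passes down to smaller ones. The resulting form has no
existential quantifier: it is an intersection of conditions on finitely many entries each, hence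
closed. -/
theorem mem_UT_iff [ZLike Λ] {a : Matrix Λ Λ R} :
    a ∈ UT Λ R ↔ IsUpper a ∧ ∀ T : Finset Λ, (T : Set Λ).OrdConnected → IsUnit (block a T) := by
  constructor
  · rintro ⟨⟨S, -, hS⟩, ha⟩
    refine ⟨ha, fun T hT => ?_⟩
    obtain ⟨T', hT', hc⟩ := exists_convex (S ∪ T)
    exact isUnit_block_of_subset ha hT hc (Finset.subset_union_right.trans hT')
      (hS T' hc (Finset.subset_union_left.trans hT'))
  · rintro ⟨ha, h⟩
    exact ⟨⟨∅, by simpa using Set.ordConnected_empty, fun T hT _ => h T hT⟩, ha⟩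

theorem continuous_block {Λ R : Type*} [TopologicalSpace R] (T : Finset Λ) :
    Continuous fun a : Matrix Λ Λ R => a.submatrix (Subtype.val : T → Λ) (Subtype.val : T → Λ) :=
  continuous_id.matrix_submatrix _ _

theorem discreteTopology_matrix {Λ R : Type*} [TopologicalSpace R] [DiscreteTopology R]
    (T : Finset Λ) : DiscreteTopology (Matrix T T R) :=
  inferInstanceAs (DiscreteTopology (T → T → R))

variable [TopologicalSpace R] [DiscreteTopology R]

theorem isClosed_UT [ZLike Λ] : IsClosed (UT Λ R) := by
  have : UT Λ R = {a | ∀ i j, ¬ i ≤ j → a i j = 0} ∩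
      {a | ∀ T : Finset Λ, (T : Set Λ).OrdConnected → IsUnit (block a T)} :=
    Set.ext fun a => mem_UT_iff
  rw [this]
  refine IsClosed.inter ?_ ?_
  · simp only [Set.ofPred_forall]
    exact isClosed_iInter fun i => isClosed_iInter fun j => isClosed_iInter fun _ =>
      isClosed_eq (continuous_id.matrix_elem i j) continuous_const
  · simp only [Set.ofPred_forall]
    refine isClosed_iInter fun T => isClosed_iInter fun _ => ?_
    have := discreteTopology_matrix (R := R) T
    exact (isClosed_discrete {m : Matrix T T R | IsUnit m}).preimage (continuous_block T)

theorem compactSpace_UT [ZLike Λ] [Finite R] : CompactSpace (UT Λ R) := by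
  have : CompactSpace (Matrix Λ Λ R) := inferInstanceAs (CompactSpace (Λ → Λ → R))
  exact isCompact_iff_compactSpace.1 isClosed_UT.isCompact

theorem continuous_mulM_UT [ZLike Λ] :
    Continuous fun p : UT Λ R × UT Λ R => mulM p.1.1 p.2.1 := by
  refine continuous_matrix fun i j => ?_
  obtain ⟨T, hT, hc⟩ := exists_convex ({i, j} : Finset Λ)
  have : (fun p : UT Λ R × UT Λ R => mulM p.1.1 p.2.1 i j) =
      fun p => ∑ k ∈ T, p.1.1 i k * p.2.1 k j :=
    funext fun p => mulM_apply p.1.2.2 p.2.2.2 hc (hT (by simp)) (hT (by simp))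
  rw [this]
  refine continuous_finsetSum _ fun k _ => ?_
  exact ((continuous_subtype_val.comp continuous_fst).matrix_elem i k).mul
    ((continuous_subtype_val.comp continuous_snd).matrix_elem k j)

/-- An entry of the inverse is an entry of the inverse of one finite block, hence a function on a
discrete space. -/
theorem continuous_leftInv_UT [ZLike Λ] (f : UT Λ R → UT Λ R)
    (hf : ∀ a, mulM (f a).1 a.1 = 1) : Continuous f := by
  refine Continuous.subtype_mk (p := fun a => a ∈ UT Λ R) (f := fun a => (f a).1)
    (continuous_matrix fun i j => ?_) _
  obtain ⟨T, hT, hc⟩ := exists_convex ({i, j} : Finset Λ)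
  have : (fun a => (f a).1 i j) = fun a : UT Λ R =>
      (block a.1 T)⁻¹ ⟨i, hT (by simp)⟩ ⟨j, hT (by simp)⟩ := by
    funext a
    rw [Matrix.inv_eq_left_inv (B := block (f a).1 T)]
    · rfl
    · rw [← block_mulM (f a).2.2 a.2.2 hc, hf, block_one]
  rw [this]
  have := discreteTopology_matrix (R := R) T
  exact (continuous_of_discreteTopology
    (f := fun m : Matrix T T R => m⁻¹ ⟨i, hT (by simp)⟩ ⟨j, hT (by simp)⟩)).comp
      ((continuous_block T).comp continuous_subtype_val)

end Preorder

namespace AU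

variable {Λ R : Type*} [Preorder Λ] [CommRing R] [ZLike Λ]

/-- Sets convex in `Λ+S` are convex in `Λ`, so nonsingularity carries over and only the vanishing of
entries has to be checked. -/
theorem mem_UT_adjoin_of_isUpper {S : Finset Λ} (a : AU Λ R)
    (h : @IsUpper Λ R (adjoin S) _ a.1) : a.1 ∈ @UT Λ R (adjoin S) _ := by
  obtain ⟨⟨S₁, -, hS₁⟩, -⟩ := a.2
  obtain ⟨T, hT, hc⟩ := @exists_convex Λ (adjoin S) (zLike_adjoin S) S₁
  exact ⟨⟨T, hc, fun T' hc' hT' => hS₁ T' (ordConnected_of_adjoin hc') (hT.trans hT')⟩, h⟩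

/-- Outside a finite set of positions, matrices in `U_{Λ+S}(R)` are upper triangular. -/
theorem exists_finset_isUpper_adjoin (S : Finset Λ) : ∃ T : Finset Λ,
    ∀ i j, ¬ i ≤ j → (adjoin S).le i j → i ∈ T ∧ j ∈ T := by
  obtain ⟨T, hT, hs⟩ := ZLike.exists_stronglyConvex S
  refine ⟨T, fun i j hij hle => ?_⟩
  rcases hle with h | ⟨p, hp, q, hq, h1, h2⟩
  · exact absurd h hij
  constructor
  · by_contra hi
    rcases hs i hi with h | h
    · exact hij ((h q (hT hq)).le.trans h2)
    · exact (h p (hT hp)).not_ge h1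
  · by_contra hj
    rcases hs j hj with h | h
    · exact (h q (hT hq)).not_ge h2
    · exact hij (h1.trans (h p (hT hp)).le)

theorem inv_mem_UT {S : Finset Λ} {a : AU Λ R} (ha : a.1 ∈ @UT Λ R (adjoin S) _) :
    (a⁻¹).1 ∈ @UT Λ R (adjoin S) _ := by
  obtain ⟨b, hb, h⟩ := @exists_inv_UT Λ R (adjoin S) _ (zLike_adjoin _) _ ha
  let b' : AU Λ R := ⟨b, mem_AU_of_mem_UT_adjoin hb⟩
  have hb' : b' * a = 1 := Subtype.ext h
  rw [← eq_inv_of_mul_eq_one_left hb']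
  exact hb

theorem exists_eq_ofUT (a b : AU Λ R) : ∃ S : Finset Λ, (S : Set Λ).OrdConnected ∧
    a ∈ Set.range (ofUT (R := R) S) ∧ b ∈ Set.range (ofUT (R := R) S) := by
  obtain ⟨S, hS⟩ := exists_mem_UT_adjoin a.2
  obtain ⟨S', hS'⟩ := exists_mem_UT_adjoin b.2
  obtain ⟨T, hT, hc⟩ := exists_convex (S ∪ S')
  exact ⟨T, hc, ⟨⟨a.1, hS _ (Finset.subset_union_left.trans hT)⟩, rfl⟩,
    ⟨⟨b.1, hS' _ (Finset.subset_union_right.trans hT)⟩, rfl⟩⟩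

variable [TopologicalSpace R]

theorem continuous_ofUT {S : Finset Λ} (hS : (S : Set Λ).OrdConnected) :
    Continuous (ofUT (R := R) S) :=
  continuous_iff_coinduced_le.2 (le_iSup (fun S : {S : Finset Λ // (S : Set Λ).OrdConnected} =>
    TopologicalSpace.coinduced (ofUT (R := R) S.1) inferInstance) ⟨S, hS⟩)

theorem isOpen_iff_preimage_ofUT {V : Set (AU Λ R)} : IsOpen V ↔
    ∀ S : Finset Λ, (S : Set Λ).OrdConnected → IsOpen (ofUT S ⁻¹' V) := by
  refine ⟨fun h S hS => h.preimage (continuous_ofUT hS), fun h => ?_⟩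
  exact isOpen_iSup_iff.2 fun S => isOpen_coinduced.2 (h S.1 S.2)

theorem continuous_val : Continuous fun a : AU Λ R => a.1 :=
  continuous_iSup_dom.2 fun _ => continuous_coinduced_dom.2 continuous_subtype_val

/-- A closed set contains every entrywise eventual limit of its elements lying in a fixed
`U_{Λ+S}(R)`. -/
theorem mem_of_eventually_eq {C : Set (AU Λ R)} (hC : IsClosed C) {S : Finset Λ}
    (hS : (S : Set Λ).OrdConnected) {a : AU Λ R} (ha : a.1 ∈ @UT Λ R (adjoin S) _) {ι : Type*}
    {l : Filter ι} [l.NeBot] (f : ι → AU Λ R) (hf : ∀ t, (f t).1 ∈ @UT Λ R (adjoin S) _)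
    (hfC : ∀ᶠ t in l, f t ∈ C) (h : ∀ i j, ∀ᶠ t in l, (f t).1 i j = a.1 i j) : a ∈ C := by
  have hlim : Filter.Tendsto (fun t => (⟨(f t).1, hf t⟩ : @UT Λ R (adjoin S) _)) l
      (nhds ⟨a.1, ha⟩) := by
    rw [tendsto_subtype_rng]
    exact tendsto_pi_nhds.2 fun i => tendsto_pi_nhds.2 fun j =>
      tendsto_const_nhds.congr' ((h i j).mono fun _ => Eq.symm)
  exact hC.mem_of_tendsto (((continuous_ofUT hS).tendsto _).comp hlim) hfC

instance [T2Space R] : T2Space (AU Λ R) := by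
  have : T2Space (Matrix Λ Λ R) := inferInstanceAs (T2Space (Λ → Λ → R))
  exact T2Space.of_injective_continuous Subtype.val_injective continuous_val

variable [DiscreteTopology R]

/-- A matrix in `U_{Λ+S'}(R)` can fail to be upper triangular for `Λ+S` only at positions in a
finite square `T × T`, and over a discrete ring finitely many vanishing conditions are open. -/
theorem isOpenEmbedding_ofUT {S : Finset Λ} (hS : (S : Set Λ).OrdConnected) :
    Topology.IsOpenEmbedding (ofUT (R := R) S) := by
  refine .of_continuous_injective_isOpenMap (continuous_ofUT hS)
    (fun u v h => Subtype.ext (congrArg (fun x : AU Λ R => x.1) h)) fun V hV => ?_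
  rw [isOpen_iff_preimage_ofUT]
  intro S' hS'
  obtain ⟨W, hW, rfl⟩ := isOpen_induced_iff.1 hV
  obtain ⟨T, hT⟩ := exists_finset_isUpper_adjoin S'
  have : ofUT S' ⁻¹' (ofUT (R := R) S '' (Subtype.val ⁻¹' W)) = Subtype.val ⁻¹' (W ∩
      ⋂ i ∈ T, ⋂ j ∈ T, {a : Matrix Λ Λ R | ¬ (adjoin S).le i j → a i j = 0}) := by
    ext u
    simp only [Set.mem_preimage, Set.mem_image, Set.mem_inter_iff, Set.mem_iInter,
      Set.mem_ofPred_eq]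
    constructor
    · rintro ⟨v, hv, hvu⟩
      have hvu' : v.1 = u.1 := congrArg (fun x : AU Λ R => x.1) hvu
      rw [← hvu']
      exact ⟨hv, fun i _ j _ => v.2.2 i j⟩
    · rintro ⟨h1, h2⟩
      refine ⟨⟨u.1, mem_UT_adjoin_of_isUpper (ofUT S' u) fun i j hij => ?_⟩, h1, rfl⟩
      by_cases hle : (adjoin S').le i j
      · obtain ⟨hi, hj⟩ := hT i j (fun h => hij (Or.inl h)) hle
        exact h2 i hi j hj hij
      · exact u.2.2 i j hle
  rw [this]
  refine (hW.inter ?_).preimage continuous_subtype_val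
  refine isOpen_biInter_finset fun i _ => isOpen_biInter_finset fun j _ => ?_
  exact (isOpen_discrete {r : R | ¬ (adjoin S).le i j → r = 0}).preimage
    (continuous_id.matrix_elem i j)

/-- Any two elements lie in a common open `U_{Λ+S}(R)`, so continuity is inherited from there. -/
instance : IsTopologicalGroup (AU Λ R) where
  continuous_mul := by
    rw [continuous_iff_continuousAt]
    rintro ⟨a, b⟩
    obtain ⟨S, hS, ⟨u, rfl⟩, ⟨v, rfl⟩⟩ := exists_eq_ofUT a b
    have he := isOpenEmbedding_ofUT (R := R) hS
    refine ((he.prodMap he).continuousAt_iff (x := (u, v))).1 (Continuous.continuousAt ?_)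
    exact (continuous_ofUT hS).comp (Continuous.subtype_mk
      (@continuous_mulM_UT Λ R (adjoin S) _ _ _ (zLike_adjoin S))
      fun p => @mulM_mem_UT Λ R (adjoin S) _ (zLike_adjoin S) _ _ p.1.2 p.2.2)
  continuous_inv := by
    rw [continuous_iff_continuousAt]
    intro a
    obtain ⟨S, hS, ⟨u, rfl⟩, -⟩ := exists_eq_ofUT a a
    refine ((isOpenEmbedding_ofUT hS).continuousAt_iff (x := u)).1 (Continuous.continuousAt ?_)
    exact (continuous_ofUT hS).comp (@continuous_leftInv_UT Λ R (adjoin S) _ _ _ (zLike_adjoin S)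
      (fun v => ⟨((ofUT S v)⁻¹).1, inv_mem_UT v.2⟩)
      fun v => congrArg (fun x : AU Λ R => x.1) (inv_mul_cancel (ofUT S v)))

instance : TotallyDisconnectedSpace (AU Λ R) := by
  have : TotallyDisconnectedSpace (Matrix Λ Λ R) :=
    inferInstanceAs (TotallyDisconnectedSpace (Λ → Λ → R))
  exact ⟨isTotallyDisconnected_of_image continuous_val.continuousOn Subtype.val_injective
    (isTotallyDisconnected_of_totallyDisconnectedSpace _)⟩

instance [Finite R] : LocallyCompactSpace (AU Λ R) := by
  have : WeaklyLocallyCompactSpace (AU Λ R) := by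
    refine ⟨fun a => ?_⟩
    obtain ⟨S, hS, ha, -⟩ := exists_eq_ofUT a a
    have := @compactSpace_UT Λ R (adjoin S) _ _ _ (zLike_adjoin S) _
    exact ⟨_, isCompact_range (continuous_ofUT hS),
      (isOpenEmbedding_ofUT hS).isOpen_range.mem_nhds ha⟩
  infer_instance

theorem isClosed_scalarSubgroup : IsClosed (scalarSubgroup Λ R : Set (AU Λ R)) := by
  have h : ∀ i j, Continuous fun a : AU Λ R => a.1 i j := fun i j => continuous_val.matrix_elem i j
  have : (scalarSubgroup Λ R : Set (AU Λ R)) =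
      {a | ∀ i j, i ≠ j → a.1 i j = 0} ∩ {a | ∀ i j, a.1 i i = a.1 j j} := rfl
  rw [this]
  simp only [Set.ofPred_forall]
  exact (isClosed_iInter fun i => isClosed_iInter fun j => isClosed_iInter fun _ =>
    isClosed_eq (h i j) continuous_const).inter
    (isClosed_iInter fun i => isClosed_iInter fun j => isClosed_eq (h i i) (h j j))

end AU

end Topology

/-! ### Commutators: a nonscalar element normally generates all elementary transvections. -/

section Transvections

open scoped Classical

namespace AU

section Ring

variable {Λ R : Type*} [Preorder Λ] [CommRing R]

/-- The matrix `1 + x eₖᵀ`, where `x` is a column vector of finite support. -/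
noncomputable def transvectionMatrix (x : Λ →₀ R) (k : Λ) : Matrix Λ Λ R :=
  fun a b => (1 : Matrix Λ Λ R) a b + if b = k then x a else 0

/-- Since `eₖᵀ y = 0`, the product of `1 + x eₖᵀ` and `1 + y eₖᵀ` is `1 + (x + y) eₖᵀ`. -/
theorem block_transvectionMatrix_mul {x y : Λ →₀ R} {k : Λ} (hx : y k = 0) (hxy : x + y = 0)
    (T : Finset Λ) :
    block (transvectionMatrix x k) T * block (transvectionMatrix y k) T = 1 := by
  set v : T → R := fun b => if b.1 = k then 1 else 0 with hv
  have key : ∀ z : Λ →₀ R, block (transvectionMatrix z k) T =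
      1 + Matrix.vecMulVec (fun a : T => z a) v := by
    intro z
    rw [← block_one]
    ext a b
    simp [block, transvectionMatrix, Matrix.vecMulVec_apply, hv]
  have h0 : v ⬝ᵥ (fun a : T => y a) = 0 := by
    refine Finset.sum_eq_zero fun b _ => ?_
    by_cases h : b.1 = k
    · simp [h, hx]
    · simp [hv, h]
  rw [key, key, add_mul, mul_add, mul_add, Matrix.vecMulVec_mul_vecMulVec, h0,
    one_mul, one_mul, mul_one, zero_smul, Matrix.vecMulVec_zero, add_zero, add_assoc,
    ← Matrix.add_vecMulVec]
  have : (fun a : T => y a) + (fun a : T => x a) = 0 := by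
    funext a
    simpa [add_comm] using DFunLike.congr_fun hxy a.1
  rw [this, Matrix.zero_vecMulVec, add_zero]

theorem transvectionMatrix_mem {x : Λ →₀ R} {k : Λ} (hx : x k = 0) :
    Nonsingular (transvectionMatrix x k) ∧ IsAlmostUpper (transvectionMatrix x k) := by
  constructor
  · exact ⟨∅, by simpa using Set.ordConnected_empty, fun T _ _ =>
      IsUnit.of_mul_eq_one _ (block_transvectionMatrix_mul (y := -x) (by simp [hx]) (by simp) T)⟩
  · refine (x.support ×ˢ {k}).finite_toSet.subset ?_
    rintro ⟨a, b⟩ ⟨hab, h⟩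
    have hne : a ≠ b := fun h => hab h.le
    rw [transvectionMatrix, Matrix.one_apply_ne hne, zero_add] at h
    have hb : b = k := by
      by_contra hb
      exact h (if_neg hb)
    rw [if_pos hb] at h
    simp [h, hb]

/-- The element `1 + x eₖᵀ` of `AU_Λ(R)`, where `x` has finite support and vanishes at `k`. -/
noncomputable def tv (x : Λ →₀ R) (k : Λ) (hx : x k = 0) : AU Λ R :=
  ⟨transvectionMatrix x k, transvectionMatrix_mem hx⟩

theorem tv_apply (x : Λ →₀ R) (k : Λ) (hx : x k = 0) (a b : Λ) :
    (tv x k hx).1 a b = (if a = b then 1 else 0) + if b = k then x a else 0 := rfl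

theorem ext_apply {g h : AU Λ R} (H : ∀ a b, g.1 a b = h.1 a b) : g = h :=
  Subtype.ext (Matrix.ext H)

variable [ZLike Λ]

theorem one_apply (a b : Λ) : (1 : AU Λ R).1 a b = if a = b then 1 else 0 := rfl

theorem mul_tv_apply (g : AU Λ R) (x : Λ →₀ R) (k : Λ) (hx : x k = 0) (a b : Λ) :
    (g * tv x k hx).1 a b =
      g.1 a b + if b = k then Finsupp.linearCombination R (g.1 a) x else 0 := by
  have h1 : (Function.support fun c => g.1 a c * if c = b then 1 else 0).Finite :=
    (Set.finite_singleton b).subset fun c hc => by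
      by_contra h
      exact hc (by simp [show c ≠ b from h])
  have h2 : (Function.support fun c => g.1 a c * if b = k then x c else 0) ⊆ x.support := by
    intro c hc
    by_contra h
    exact hc (by simp [Finsupp.notMem_support_iff.1 h])
  rw [mul_val, mulM]
  simp only [tv_apply, mul_add]
  rw [finsum_add_distrib h1 (x.support.finite_toSet.subset h2), finsum_eq_single _ b,
    finsum_eq_sum_of_support_subset _ h2]
  · congr 1
    · simp
    · by_cases h : b = k
      · simp [h, Finsupp.linearCombination_apply, Finsupp.sum, mul_comm]
      · simp [h]
  · intro c hc
    simp [hc]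

theorem tv_mul_apply (g : AU Λ R) (x : Λ →₀ R) (k : Λ) (hx : x k = 0) (a b : Λ) :
    (tv x k hx * g).1 a b = g.1 a b + x a * g.1 k b := by
  have h1 : (Function.support fun c => (if a = c then (1 : R) else 0) * g.1 c b) ⊆ {a} :=
    fun c hc => by
      by_contra h
      exact hc (by simp [show a ≠ c from fun h' => h h'.symm])
  have h2 : (Function.support fun c => (if c = k then x a else 0) * g.1 c b) ⊆ {k} := by
    intro c hc
    by_contra h
    exact hc (by simp [show c ≠ k from h])
  rw [mul_val, mulM]
  simp only [tv_apply, add_mul]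
  rw [finsum_add_distrib ((Set.finite_singleton a).subset h1)
    ((Set.finite_singleton k).subset h2), finsum_eq_single _ a, finsum_eq_single _ k]
  · simp
  · intro c hc
    simp [hc]
  · intro c hc
    simp [hc.symm]

theorem mul_tv_mul_inv_apply (g : AU Λ R) (x : Λ →₀ R) (k : Λ) (hx : x k = 0) (a b : Λ) :
    (g * tv x k hx * g⁻¹).1 a b =
      (if a = b then 1 else 0) + Finsupp.linearCombination R (g.1 a) x * (g⁻¹).1 k b := by
  have h2 : (Function.support fun c =>
      (if c = k then Finsupp.linearCombination R (g.1 a) x else 0) * (g⁻¹).1 c b) ⊆ {k} := by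
    intro c hc
    by_contra h
    exact hc (by simp [show c ≠ k from h])
  rw [mul_val, mulM]
  simp only [mul_tv_apply, add_mul]
  rw [finsum_add_distrib (finite_support_mul g g⁻¹ a b) ((Set.finite_singleton k).subset h2),
    finsum_eq_single (fun c => (if c = k then _ else 0) * _) k]
  · rw [if_pos rfl]
    congr 1
    change (g * g⁻¹).1 a b = _
    rw [mul_inv_cancel, one_apply]
  · intro c hc
    simp [hc]

theorem tv_mul_tv (x y : Λ →₀ R) (k : Λ) (hx : x k = 0) (hy : y k = 0) :
    tv x k hx * tv y k hy = tv (x + y) k (by simp [hx, hy]) := by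
  refine ext_apply fun a b => ?_
  rw [tv_mul_apply, tv_apply, tv_apply, tv_apply, hy]
  by_cases hb : b = k
  · subst hb
    simp [add_assoc, add_comm (y a)]
  · simp [hb, Ne.symm hb]

theorem tv_zero (k : Λ) : tv (0 : Λ →₀ R) k rfl = 1 :=
  ext_apply fun a b => by simp [tv_apply, one_apply]

theorem tv_inv (x : Λ →₀ R) (k : Λ) (hx : x k = 0) :
    (tv x k hx)⁻¹ = tv (-x) k (by simp [hx]) := by
  refine inv_eq_of_mul_eq_one_right ?_
  rw [tv_mul_tv, ← tv_zero k]
  congr 1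
  simp

/-- The hypotheses say `eₖᵀ g = eₖᵀ` and `g x = y`, so conjugation by `g` turns `1 + x eₖᵀ` into `1
+ y eₖᵀ`. The commutator computations below that change a row or a column rest on this. -/
theorem mul_tv_eq {g : AU Λ R} {x y : Λ →₀ R} {k : Λ} (hx : x k = 0) (hy : y k = 0)
    (hrow : ∀ b, g.1 k b = if k = b then 1 else 0)
    (hxy : ∀ a, Finsupp.linearCombination R (g.1 a) x = y a) :
    g * tv x k hx = tv y k hy * g := by
  refine ext_apply fun a b => ?_
  rw [mul_tv_apply, tv_mul_apply, hxy, hrow]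
  by_cases hb : b = k
  · simp [hb]
  · simp [hb, Ne.symm hb]

/-- A matrix commuting with all off-diagonal matrix units is scalar: column `i` of `g` must be `g_jj
eᵢ` for every `j ≠ i`. -/
theorem exists_single_not_commute {g : AU Λ R} (hg : g ∉ scalarSubgroup Λ R) :
    ∃ (i j : Λ) (h : Finsupp.single i (1 : R) j = 0),
      g * tv (Finsupp.single i 1) j h ≠ tv (Finsupp.single i 1) j h * g := by
  by_contra! H
  have key : ∀ i j a, i ≠ j → g.1 a i = if i = a then g.1 j j else 0 := by
    intro i j a hij
    have := congrArg (fun u : AU Λ R => u.1 a j) (H i j (Finsupp.single_eq_of_ne' hij))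
    simp only [mul_tv_apply, tv_mul_apply, if_true, Finsupp.linearCombination_single,
      one_smul, add_right_inj, Finsupp.single_apply] at this
    rw [this]
    simp
  refine hg ⟨fun a i hai => ?_, fun i j => ?_⟩
  · have := key i a a (Ne.symm hai)
    rwa [if_neg (Ne.symm hai)] at this
  · by_cases hij : i = j
    · rw [hij]
    · simpa using key i j i hij

end Ring

section Field

variable {Λ F : Type*} [Preorder Λ] [ZLike Λ] [Field F] {N : Subgroup (AU Λ F)} [hN : N.Normal]

theorem linearCombination_add_single {Λ R : Type*} [CommRing R] (z : Λ →₀ R) (a p : Λ) (c : R) :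
    Finsupp.linearCombination R (Pi.single a 1 + Pi.single p c : Λ → R) z = z a + z p * c := by
  induction z using Finsupp.induction_linear with
  | zero => simp
  | add u v hu hv => rw [map_add, hu, hv, Finsupp.add_apply, Finsupp.add_apply]; ring
  | single i r => simp [Finsupp.single_apply, Pi.single_apply, mul_add, eq_comm (a := i)]

/-- Conjugation by `1 + (c / z_p) e_l e_pᵀ` replaces `z` by `z + c e_l` and keeps the column `m`;
dividing by the original element leaves `1 + c e_l e_mᵀ`. -/
theorem single_row_mem {z : Λ →₀ F} {m : Λ} (hz : z m = 0) (h : tv z m hz ∈ N) {l p : Λ}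
    (hlm : l ≠ m) (hlp : l ≠ p) (hp : z p ≠ 0) (c : F) :
    tv (Finsupp.single l c) m (Finsupp.single_eq_of_ne' hlm) ∈ N := by
  set e : AU Λ F := tv (Finsupp.single l (c / z p)) p (Finsupp.single_eq_of_ne' hlp) with he
  have H : e * tv z m hz =
      tv (Finsupp.single l c + z) m (by simp [hz, Finsupp.single_eq_of_ne' hlm]) * e := by
    refine mul_tv_eq _ _ (fun b => ?_) fun a => ?_
    · simp [he, tv_apply, Finsupp.single_eq_of_ne hlm.symm]
    · have : e.1 a = Pi.single a 1 + Pi.single p (Finsupp.single l (c / z p) a) := by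
        funext b
        simp only [he, tv_apply, Pi.add_apply, Pi.single_apply, eq_comm]
      rw [this, linearCombination_add_single]
      by_cases hla : l = a
      · simp [hla, mul_div_cancel₀ _ hp, add_comm]
      · simp [Finsupp.single_eq_of_ne' hla]
  rw [← tv_mul_tv _ _ _ (Finsupp.single_eq_of_ne' hlm) hz] at H
  have : tv (Finsupp.single l c) m (Finsupp.single_eq_of_ne' hlm) =
      (e * tv z m hz * e⁻¹) * (tv z m hz)⁻¹ := by
    rw [H]; group
  rw [this]
  exact N.mul_mem (hN.conj_mem _ h e) (N.inv_mem h)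

/-- The commutator of `1 + c e_l e_mᵀ` with `1 + e_m e_m'ᵀ` is `1 + c e_l e_m'ᵀ`. -/
theorem single_column_mem {l m m' : Λ} {c : F} (hlm : l ≠ m) (hlm' : l ≠ m') (hm : m ≠ m')
    (h : tv (Finsupp.single l c) m (Finsupp.single_eq_of_ne' hlm) ∈ N) :
    tv (Finsupp.single l c) m' (Finsupp.single_eq_of_ne' hlm') ∈ N := by
  set f : AU Λ F := tv (Finsupp.single l c) m (Finsupp.single_eq_of_ne' hlm) with hf
  set e : AU Λ F := tv (Finsupp.single m 1) m' (Finsupp.single_eq_of_ne' hm) with he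
  have H : f * e = tv (Finsupp.single l c + Finsupp.single m 1) m'
      (by simp [Finsupp.single_eq_of_ne' hlm', Finsupp.single_eq_of_ne' hm]) * f := by
    refine mul_tv_eq _ _ (fun b => ?_) fun a => ?_
    · simp [hf, tv_apply, Finsupp.single_eq_of_ne hlm'.symm]
    · simp [hf, tv_apply, Finsupp.single_apply, add_comm, eq_comm]
  rw [← tv_mul_tv _ _ _ (Finsupp.single_eq_of_ne' hlm') (Finsupp.single_eq_of_ne' hm)] at H
  have : tv (Finsupp.single l c) m' (Finsupp.single_eq_of_ne' hlm') =
      f * (e * f⁻¹ * e⁻¹) := by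
    rw [← mul_assoc, ← mul_assoc, H]; group
    rw [mul_assoc, ← he]; group
  rw [this]
  exact N.mul_mem h (hN.conj_mem _ (N.inv_mem h) e)

/-- A normal subgroup containing a nontrivial `1 + z eₘᵀ` contains all elementary transvections. -/
theorem single_mem_of_tv_mem [Infinite Λ] {z : Λ →₀ F} {m : Λ} (hz : z m = 0)
    (h : tv z m hz ∈ N) (hz0 : z ≠ 0) {i j : Λ} (hij : i ≠ j) (c : F) :
    tv (Finsupp.single i c) j (Finsupp.single_eq_of_ne' hij) ∈ N := by
  obtain ⟨p, hp⟩ : ∃ p, z p ≠ 0 := by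
    by_contra! H
    exact hz0 (Finsupp.ext H)
  -- A fresh row `l` as intermediary: move to row `l` in column `m`, then to column `j`, and finally
  -- to row `i`.
  obtain ⟨l, hl⟩ := Infinite.exists_notMem_finset ({m, p, i, j} : Finset Λ)
  simp only [Finset.mem_insert, Finset.mem_singleton, not_or] at hl
  obtain ⟨hlm, hlp, hli, hlj⟩ := hl
  have h1 : tv (Finsupp.single l (1 : F)) m (Finsupp.single_eq_of_ne' hlm) ∈ N :=
    single_row_mem hz h hlm hlp hp 1
  have h2 : tv (Finsupp.single l (1 : F)) j (Finsupp.single_eq_of_ne' hlj) ∈ N := by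
    by_cases hmj : m = j
    · subst hmj
      exact h1
    · exact single_column_mem hlm hlj hmj h1
  exact single_row_mem _ h2 hij (Ne.symm hli) (p := l) (by simp) c

/-- A normal subgroup containing a nonscalar matrix contains all elementary transvections. -/
theorem single_mem_of_not_scalar [Infinite Λ] {g : AU Λ F} (hgN : g ∈ N)
    (hg : g ∉ scalarSubgroup Λ F) {i j : Λ} (hij : i ≠ j) (c : F) :
    tv (Finsupp.single i c) j (Finsupp.single_eq_of_ne' hij) ∈ N := by
  obtain ⟨i', j', hij', hne⟩ := exists_single_not_commute hg
  set t : AU Λ F := tv (Finsupp.single i' 1) j' hij' with ht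
  set h : AU Λ F := g * t * g⁻¹ * t⁻¹ with hh
  have hhN : h ∈ N := by
    rw [hh, mul_assoc, mul_assoc, ← mul_assoc t]
    exact N.mul_mem hgN (hN.conj_mem _ (N.inv_mem hgN) t)
  have hh1 : h⁻¹ ≠ 1 := by
    intro H
    rw [inv_eq_one] at H
    apply hne
    calc g * t = h * t * g := by rw [hh]; group
      _ = t * g := by rw [H, one_mul]
  -- Row `k` of `h⁻¹` differs from `eₖᵀ`; this difference becomes the row factor of the rank one
  -- matrix `n - 1` below.
  obtain ⟨k, y, hky⟩ : ∃ k y, (h⁻¹).1 k y ≠ if k = y then 1 else 0 := by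
    by_contra! H
    exact hh1 (ext_apply H)
  have hcol : ∀ a p, p ≠ j' → h.1 a p = (if a = p then 1 else 0) + g.1 a i' * (g⁻¹).1 j' p := by
    intro a p hp
    rw [hh, ht, tv_inv, mul_tv_apply, if_neg hp, add_zero, mul_tv_mul_inv_apply]
    simp
  -- Off column `j'` the commutator `h` is the identity plus a rank one matrix with row factor row
  -- `j'` of `g⁻¹`. A combination of `e_p` and `e_q` killed by that row is therefore fixed by `h`.
  obtain ⟨p, q, α, hpj, hpk, hqj, hqk, hpq, hα⟩ : ∃ (p q : Λ) (α : F), p ≠ j' ∧ p ≠ k ∧ q ≠ j' ∧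
      q ≠ k ∧ p ≠ q ∧ (g⁻¹).1 j' p + α * (g⁻¹).1 j' q = 0 := by
    obtain ⟨p, hp⟩ := Infinite.exists_notMem_finset ({j', k} : Finset Λ)
    obtain ⟨q, hq⟩ := Infinite.exists_notMem_finset ({j', k, p} : Finset Λ)
    simp only [Finset.mem_insert, Finset.mem_singleton, not_or] at hp hq
    by_cases h0 : (g⁻¹).1 j' q = 0
    · exact ⟨q, p, 0, hq.1, hq.2.1, hp.1, hp.2, hq.2.2, by simp [h0]⟩
    · exact ⟨p, q, -(g⁻¹).1 j' p / (g⁻¹).1 j' q, hp.1, hp.2, hq.1, hq.2.1, Ne.symm hq.2.2,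
        by field_simp; ring⟩
  set x : Λ →₀ F := Finsupp.single p 1 + Finsupp.single q α with hx
  have hxk : x k = 0 := by
    simp [hx, Finsupp.single_eq_of_ne' hpk, Finsupp.single_eq_of_ne' hqk]
  have hhx : ∀ a, Finsupp.linearCombination F (h.1 a) x = x a := by
    intro a
    simp only [hx, map_add, Finsupp.linearCombination_single, hcol a p hpj, hcol a q hqj,
      Finsupp.add_apply, Finsupp.single_apply, smul_eq_mul, eq_comm (a := a)]
    have : ∀ u v : F, (1 : F) * (u + g.1 a i' * (g⁻¹).1 j' p) +
        α * (v + g.1 a i' * (g⁻¹).1 j' q) = u + α * v := fun u v => by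
      linear_combination g.1 a i' * hα
    rw [this]
    simp
  set n : AU Λ F := (tv x k hxk)⁻¹ * (h * tv x k hxk * h⁻¹) with hn
  have hnN : n ∈ N := by
    have : n = ((tv x k hxk)⁻¹ * h * (tv x k hxk)⁻¹⁻¹) * h⁻¹ := by rw [hn]; group
    rw [this]
    exact N.mul_mem (hN.conj_mem _ hhN _) (N.inv_mem hhN)
  -- Because `h x = x` and `x_k = 0`, the commutator `n` equals `1 + x (eₖᵀ h⁻¹ - eₖᵀ)`.
  have hnab : ∀ a b, n.1 a b = (if a = b then 1 else 0) +
      x a * ((h⁻¹).1 k b - if k = b then 1 else 0) := by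
    intro a b
    rw [hn, tv_inv, tv_mul_apply, mul_tv_mul_inv_apply, mul_tv_mul_inv_apply, hhx, hhx, hxk,
      Finsupp.neg_apply]
    ring
  set η : F := (h⁻¹).1 k y - if k = y then 1 else 0 with hη
  have hη0 : η ≠ 0 := sub_ne_zero.2 hky
  obtain ⟨m, hm⟩ := Infinite.exists_notMem_finset ({y, p, q} : Finset Λ)
  simp only [Finset.mem_insert, Finset.mem_singleton, not_or] at hm
  obtain ⟨hmy, hmp, hmq⟩ := hm
  have hxm : x m = 0 := by
    simp [hx, Finsupp.single_eq_of_ne hmp, Finsupp.single_eq_of_ne hmq]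
  have hym : Finsupp.single y (1 : F) m = 0 := Finsupp.single_eq_of_ne hmy
  set r : AU Λ F := tv (Finsupp.single y 1) m hym with hr
  have hz : (η • x) m = 0 := by simp [hxm]
  -- Here `n e_y = e_y + η x`, and row `m` of `n` is trivial, so the commutator of `n` with `r` is
  -- `1 + η x e_mᵀ`.
  have H : n * r = tv (η • x + Finsupp.single y 1) m (by simp [hxm, hym]) * n := by
    refine mul_tv_eq _ _ (fun b => ?_) fun a => ?_
    · rw [hnab, hxm, zero_mul, add_zero]
    · have hsum : (η • x + Finsupp.single y (1 : F) : Λ →₀ F) a =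
          η * x a + if a = y then 1 else 0 := by
        simp [Finsupp.single_apply, eq_comm (a := a)]
      rw [Finsupp.linearCombination_single, hsum, hnab, one_smul]
      ring
  rw [← tv_mul_tv _ _ _ hz hym] at H
  have hzN : tv (η • x) m hz ∈ N := by
    have : tv (η • x) m hz = n * (r * n⁻¹ * r⁻¹) := by
      rw [← mul_assoc, ← mul_assoc, H]
      group
      rw [mul_assoc, ← hr]
      group
    rw [this]
    exact N.mul_mem hnN (hN.conj_mem _ (N.inv_mem hnN) r)
  refine single_mem_of_tv_mem hz hzN (fun h0 => ?_) hij c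
  have := DFunLike.congr_fun h0 p
  simp [hx, hη0, Finsupp.single_eq_of_ne hpq] at this

end Field

end AU

end Transvections

/-! ### Density of the subgroup generated by elementary transvections, and the main theorem. -/

section Density

open scoped Classical

namespace AU

section Matrix

variable {Λ F : Type*} [Field F]

theorem update_ne_zero {d : Λ → F} (hd : ∀ i, d i ≠ 0) (i : Λ) {x : F} (hx : x ≠ 0) (j : Λ) :
    Function.update d i x j ≠ 0 := by
  by_cases h : j = i
  · simpa [h] using hx
  · simpa [h] using hd j

/-- The matrix that agrees with `A` on `T × T` and with the identity elsewhere. -/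
noncomputable def extendMatrix {T : Finset Λ} (A : Matrix T T F) : Matrix Λ Λ F :=
  fun i j => if h : i ∈ T ∧ j ∈ T then A ⟨i, h.1⟩ ⟨j, h.2⟩ else (1 : Matrix Λ Λ F) i j

theorem extendMatrix_of_mem {T : Finset Λ} (A : Matrix T T F) (i j : T) :
    extendMatrix A i.1 j.1 = A i j := dif_pos ⟨i.2, j.2⟩

theorem extendMatrix_of_notMem {T : Finset Λ} (A : Matrix T T F) {i j : Λ}
    (h : ¬ (i ∈ T ∧ j ∈ T)) : extendMatrix A i j = if i = j then 1 else 0 := dif_neg h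

theorem support_extendMatrix {T T' : Finset Λ} (hTT' : T ⊆ T') (A B : Matrix T T F) {i : Λ}
    (hi : i ∈ T') (j : Λ) :
    (Function.support fun k => extendMatrix A i k * extendMatrix B k j) ⊆ (T' : Set Λ) := by
  intro k hk
  by_contra hkT
  have hki : i ≠ k := by
    rintro rfl
    exact hkT hi
  exact hk (by simp [extendMatrix_of_notMem A (fun h => hkT (hTT' h.2)), hki])

theorem mulM_extendMatrix {T : Finset Λ} (A B : Matrix T T F) :
    mulM (extendMatrix A) (extendMatrix B) = extendMatrix (A * B) := by
  ext i j
  by_cases hi : i ∈ T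
  · by_cases hj : j ∈ T
    · rw [mulM, finsum_eq_sum_of_support_subset _ (support_extendMatrix subset_rfl A B hi j),
        extendMatrix_of_mem (A * B) ⟨i, hi⟩ ⟨j, hj⟩, Matrix.mul_apply, ← Finset.sum_coe_sort]
      exact Finset.sum_congr rfl fun k _ => congrArg₂ _
        (extendMatrix_of_mem A ⟨i, hi⟩ k) (extendMatrix_of_mem B k ⟨j, hj⟩)
    · rw [mulM, finsum_eq_single _ j, extendMatrix_of_notMem _ (fun h => hj h.2),
        extendMatrix_of_notMem _ (fun h => hj h.2), extendMatrix_of_notMem _ (fun h => hj h.2)]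
      · simp
      · intro k hk
        rw [extendMatrix_of_notMem B (fun h => hj h.2), if_neg hk, mul_zero]
  · rw [mulM, finsum_eq_single _ i, extendMatrix_of_notMem _ (fun h => hi h.1),
      extendMatrix_of_notMem _ (fun h => hi h.1), extendMatrix_of_notMem _ (fun h => hi h.1)]
    · simp
    · intro k hk
      rw [extendMatrix_of_notMem A (fun h => hi h.1), if_neg hk.symm, zero_mul]

theorem extendMatrix_one {T : Finset Λ} : extendMatrix (1 : Matrix T T F) = 1 := by
  ext i j
  rw [extendMatrix]
  split_ifs with h
  · simp [Matrix.one_apply]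
  · rfl

end Matrix

variable {Λ F : Type*} [Preorder Λ] [Field F]

theorem diagonal_mem {d : Λ → F} (hd : ∀ i, d i ≠ 0) :
    Nonsingular (Matrix.diagonal d) ∧ IsAlmostUpper (Matrix.diagonal d) := by
  constructor
  · refine ⟨∅, by simpa using Set.ordConnected_empty, fun T _ _ => ?_⟩
    have : block (Matrix.diagonal d) T = Matrix.diagonal fun i : T => d i :=
      Matrix.submatrix_diagonal _ _ Subtype.val_injective
    rw [this, Matrix.isUnit_iff_isUnit_det, Matrix.det_diagonal, isUnit_iff_ne_zero]
    exact Finset.prod_ne_zero_iff.2 fun i _ => hd i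
  · refine Set.finite_empty.subset ?_
    rintro ⟨i, j⟩ ⟨hij, h⟩
    exact h (Matrix.diagonal_apply_ne _ fun h => hij h.le)

/-- The diagonal matrix with nonzero diagonal entries `d`, as an element of `AU_Λ(F)`. -/
noncomputable def diag (d : Λ → F) (hd : ∀ i, d i ≠ 0) : AU Λ F :=
  ⟨Matrix.diagonal d, diagonal_mem hd⟩

theorem diag_apply (d : Λ → F) (hd : ∀ i, d i ≠ 0) (a b : Λ) :
    (diag d hd).1 a b = if a = b then d a else 0 := rfl

theorem extendMatrix_mem [ZLike Λ] {T : Finset Λ} {A : Matrix T T F} (hA : IsUnit A) :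
    Nonsingular (extendMatrix A) ∧ IsAlmostUpper (extendMatrix A) := by
  constructor
  · obtain ⟨S, hS, hc⟩ := exists_convex T
    refine ⟨S, hc, fun T' _ hST' => ?_⟩
    obtain ⟨B, hB⟩ := hA.exists_right_inv
    refine IsUnit.of_mul_eq_one (block (extendMatrix B) T') ?_
    rw [← block_one, ← extendMatrix_one (T := T), ← hB, ← mulM_extendMatrix]
    ext i j
    simp only [block, Matrix.submatrix_apply, Matrix.mul_apply]
    rw [mulM, finsum_eq_sum_of_support_subset _
      (support_extendMatrix (hS.trans hST') A B i.2 j.1)]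
    exact Finset.sum_coe_sort T' fun k => extendMatrix A i.1 k * extendMatrix B k j.1
  · refine (T ×ˢ T).finite_toSet.subset ?_
    rintro ⟨i, j⟩ ⟨hij, h⟩
    have : i ≠ j := fun h => hij h.le
    by_contra hT
    exact h ((extendMatrix_of_notMem A (by simpa using hT)).trans (if_neg this))

/-- The invertible matrix `A` on `T`, extended by the identity, as an element of `AU_Λ(F)`. -/
noncomputable def extend [ZLike Λ] {T : Finset Λ} (A : Matrix T T F) (hA : IsUnit A) : AU Λ F :=
  ⟨extendMatrix A, extendMatrix_mem hA⟩

section Diagonal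

variable [ZLike Λ]

theorem diag_mul_apply (d : Λ → F) (hd : ∀ i, d i ≠ 0) (g : AU Λ F) (a b : Λ) :
    (diag d hd * g).1 a b = d a * g.1 a b := by
  rw [mul_val, mulM, finsum_eq_single _ a, diag_apply, if_pos rfl]
  intro c hc
  rw [diag_apply, if_neg hc.symm, zero_mul]

theorem diag_mem_UT (d : Λ → F) (hd : ∀ i, d i ≠ 0) (S : Finset Λ) :
    (diag d hd).1 ∈ @UT Λ F (adjoin S) _ :=
  mem_UT_adjoin_of_isUpper _ fun i j hij =>
    (diag_apply d hd i j).trans (if_neg (by rintro rfl; exact hij ((adjoin S).le_refl i)))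

/-- The subgroup `N` contains all elementary transvections. -/
def ContainsElementary (N : Subgroup (AU Λ F)) : Prop :=
  ∀ (i j : Λ) (hij : i ≠ j) (c : F),
    tv (Finsupp.single i c) j (Finsupp.single_eq_of_ne' hij) ∈ N

variable {N : Subgroup (AU Λ F)}

theorem diag_update_update_mem (hsingle : ContainsElementary N) {i m : Λ} (him : i ≠ m)
    {x : F} (hx : x ≠ 0)
    (h : ∀ k, Function.update (Function.update (1 : Λ → F) m x⁻¹) i x k ≠ 0) :
    diag (Function.update (Function.update (1 : Λ → F) m x⁻¹) i x) h ∈ N := by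
  set D := diag (Function.update (Function.update (1 : Λ → F) m x⁻¹) i x) h with hD
  set E : F → AU Λ F := fun c => tv (Finsupp.single i c) m (Finsupp.single_eq_of_ne' him) with hE
  set E' : F → AU Λ F := fun c => tv (Finsupp.single m c) i (Finsupp.single_eq_of_ne' him.symm)
    with hE'
  -- On the rows and columns `i, m`, in this order, both sides are the matrix with rows `(x, -1)`
  -- and `(1, 0)`.
  have H : E' x⁻¹ * (E (-x) * D) = E (x - 1) * (E' 1 * E (-1)) := by
    refine ext_apply fun a b => ?_
    simp only [hE, hE', tv_mul_apply, hD, diag_apply, tv_apply, Finsupp.single_apply]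
    by_cases ha : a = i
    · subst ha
      by_cases hb : b = a
      · subst hb
        simp [him, him.symm]
      · by_cases hb' : b = m
        · subst hb'
          simp [him, him.symm, hx]
        · simp [him.symm, hb', Ne.symm hb, Ne.symm hb']
    · by_cases ha' : a = m
      · subst ha'
        by_cases hb : b = i
        · subst hb
          simp [him, him.symm, hx]
        · by_cases hb' : b = a
          · subst hb'
            simp [him, him.symm, hx]
          · simp [him, hb', Ne.symm hb, Ne.symm hb']
      · simp [ha, ha', Ne.symm ha, Ne.symm ha']
  have hEN : ∀ c, E c ∈ N := hsingle i m him
  have hEN' : ∀ c, E' c ∈ N := hsingle m i him.symm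
  have : D = (E (-x))⁻¹ * ((E' x⁻¹)⁻¹ * (E (x - 1) * (E' 1 * E (-1)))) := by
    rw [← H]; group
  rw [this]
  exact N.mul_mem (N.inv_mem (hEN _)) (N.mul_mem (N.inv_mem (hEN' _))
    (N.mul_mem (hEN _) (N.mul_mem (hEN' _) (hEN _))))

variable [Infinite Λ] [TopologicalSpace F]

/-- Elementary transvections give the entry `x` at `i` only together with `x⁻¹` at some `m`. As `m`
leaves every finite set, these matrices converge entrywise within the upper triangular group, and
the entry `x⁻¹` is lost in the limit. -/
theorem diag_update_mem (hsingle : ContainsElementary N)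
    (hclosed : IsClosed (N : Set (AU Λ F))) (i : Λ) {x : F} (hx : x ≠ 0)
    (h : ∀ k, Function.update (1 : Λ → F) i x k ≠ 0) :
    diag (Function.update (1 : Λ → F) i x) h ∈ N := by
  have hne : ∀ m k, Function.update (Function.update (1 : Λ → F) m x⁻¹) i x k ≠ 0 := fun m =>
    update_ne_zero (update_ne_zero (fun _ => one_ne_zero) m (inv_ne_zero hx)) i hx
  refine mem_of_eventually_eq hclosed (S := ∅) (by simpa using Set.ordConnected_empty)
    (diag_mem_UT _ h _) (l := Filter.cofinite) (fun m => diag _ (hne m))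
    (fun m => diag_mem_UT _ _ _) ?_ fun a b => ?_
  · filter_upwards [(Set.finite_singleton i).compl_mem_cofinite] with m hm
    exact diag_update_update_mem hsingle (Ne.symm hm) hx _
  · filter_upwards [(Set.finite_singleton a).compl_mem_cofinite] with m hm
    have hma : a ≠ m := Ne.symm hm
    rw [diag_apply, diag_apply]
    by_cases hai : a = i
    · simp [hai]
    · simp [Function.update_of_ne hai, Function.update_of_ne hma]

theorem diag_mem_of_finset (hsingle : ContainsElementary N)
    (hclosed : IsClosed (N : Set (AU Λ F))) (s : Finset Λ) :
    ∀ (d : Λ → F) (hd : ∀ i, d i ≠ 0), (∀ i, i ∉ s → d i = 1) → diag d hd ∈ N := by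
  induction s using Finset.induction_on with
  | empty =>
    intro d hd h
    have : diag d hd = 1 := ext_apply fun a b => by
      rw [diag_apply, one_apply, h a (Finset.notMem_empty a)]
    rw [this]
    exact N.one_mem
  | insert i s _ ih =>
    intro d hd h
    have : diag d hd = diag (Function.update (1 : Λ → F) i (d i))
          (update_ne_zero (fun _ => one_ne_zero) i (hd i)) *
        diag (Function.update d i 1) (update_ne_zero hd i one_ne_zero) := by
      refine ext_apply fun a b => ?_
      rw [diag_mul_apply, diag_apply, diag_apply]
      by_cases hai : a = i
      · simp [hai]
      · simp [Function.update_of_ne hai]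
    rw [this]
    refine N.mul_mem (diag_update_mem hsingle hclosed i (hd i) _) (ih _ _ fun j hj => ?_)
    by_cases hji : j = i
    · simp [hji]
    · rw [Function.update_of_ne hji]
      exact h j (by simp [hji, hj])

theorem extend_mem (hsingle : ContainsElementary N)
    (hclosed : IsClosed (N : Set (AU Λ F))) {T : Finset Λ} (A : Matrix T T F)
    (hA : IsUnit A) : extend A hA ∈ N := by
  suffices H : ∀ h : IsUnit A, extend A h ∈ N from H hA
  -- Gaussian elimination: invertible matrices over a field are products of transvections and
  -- invertible diagonal matrices.
  refine Matrix.diagonal_transvection_induction_of_det_ne_zero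
    (fun A => ∀ h : IsUnit A, extend A h ∈ N) A ?_ ?_ ?_ ?_
  · exact ((Matrix.isUnit_iff_isUnit_det _).1 hA).ne_zero
  · intro D hD h
    rw [Matrix.det_diagonal, Finset.prod_ne_zero_iff] at hD
    have : extend (Matrix.diagonal D) h = diag (fun i => if h : i ∈ T then D ⟨i, h⟩ else 1)
        (fun i => by
          by_cases hi : i ∈ T
          · simpa [hi] using hD ⟨i, hi⟩ (Finset.mem_univ _)
          · simp [hi]) := by
      refine ext_apply fun a b => ?_
      change extendMatrix _ a b = _
      rw [diag_apply]
      by_cases hT : a ∈ T ∧ b ∈ T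
      · refine (extendMatrix_of_mem _ ⟨a, hT.1⟩ ⟨b, hT.2⟩).trans ?_
        simp [Matrix.diagonal_apply, hT.1]
      · rw [extendMatrix_of_notMem _ hT]
        by_cases hab : a = b
        · subst hab
          simp [show a ∉ T from fun h => hT ⟨h, h⟩]
        · simp [hab]
    rw [this]
    exact diag_mem_of_finset hsingle hclosed T _ _ fun i hi => by simp [hi]
  · rintro ⟨i, j, hij, c⟩ h
    have hij' : i.1 ≠ j.1 := fun h => hij (Subtype.ext h)
    have : extend (Matrix.TransvectionStruct.toMatrix ⟨i, j, hij, c⟩) h =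
        tv (Finsupp.single i.1 c) j.1 (Finsupp.single_eq_of_ne' hij') := by
      refine ext_apply fun a b => ?_
      change extendMatrix _ a b = _
      rw [tv_apply]
      by_cases hT : a ∈ T ∧ b ∈ T
      · refine (extendMatrix_of_mem _ ⟨a, hT.1⟩ ⟨b, hT.2⟩).trans ?_
        simp only [Matrix.TransvectionStruct.toMatrix_mk, Matrix.transvection, Matrix.add_apply,
          Matrix.one_apply, Matrix.single_apply, Subtype.ext_iff, Finsupp.single_apply]
        by_cases hb : b = j
        · simp [hb]
        · simp [hb, Ne.symm hb]
      · rw [extendMatrix_of_notMem _ hT]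
        by_cases hb : b = j
        · have ha : i.1 ≠ a := by
            rintro rfl
            exact hT ⟨i.2, hb ▸ j.2⟩
          simp [Finsupp.single_eq_of_ne' ha]
        · simp [hb]
    rw [this]
    exact hsingle _ _ hij' c
  · intro A B hA hB ihA ihB h
    have hA' : IsUnit A := (Matrix.isUnit_iff_isUnit_det _).2 (isUnit_iff_ne_zero.2 hA)
    have hB' : IsUnit B := (Matrix.isUnit_iff_isUnit_det _).2 (isUnit_iff_ne_zero.2 hB)
    have : extend (A * B) h = extend A hA' * extend B hB' :=
      Subtype.ext (mulM_extendMatrix A B).symm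
    rw [this]
    exact N.mul_mem (ihA hA') (ihB hB')

/-- The elementary transvections generate a dense subgroup of `AU_Λ(F)`. -/
theorem eq_top_of_single_mem (hsingle : ContainsElementary N)
    (hclosed : IsClosed (N : Set (AU Λ F))) : N = ⊤ := by
  refine eq_top_iff.2 fun a _ => ?_
  obtain ⟨S, hS, ⟨u, rfl⟩, -⟩ := exists_eq_ofUT a a
  have hu := (@mem_UT_iff Λ F (adjoin S) _ (zLike_adjoin S) _).1 u.2
  -- Including `S` makes `H T` convex for `Λ+S` as well, so that the block of `u` on it is
  -- invertible.
  choose H hH hHc using fun T : Finset Λ => exists_convex (S ∪ T)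
  have hunit : ∀ T, IsUnit (block u.1 (H T)) := fun T =>
    hu.2 _ (ordConnected_adjoin (Finset.subset_union_left.trans (hH T)) (hHc T))
  -- The truncations of `u` to `H T`, completed by the identity, stay in the same `U_{Λ+S}(F)`, and
  -- each entry is eventually that of `u`.
  refine mem_of_eventually_eq hclosed hS u.2 (l := Filter.atTop)
    (fun T => extend (block u.1 (H T)) (hunit T)) (fun T => ?_)
    (Filter.Eventually.of_forall fun T => extend_mem hsingle hclosed _ _) fun i j => ?_
  · refine mem_UT_adjoin_of_isUpper _ fun i j hij => ?_
    change extendMatrix _ i j = 0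
    by_cases hT : i ∈ H T ∧ j ∈ H T
    · exact (extendMatrix_of_mem _ ⟨i, hT.1⟩ ⟨j, hT.2⟩).trans (hu.1 i j hij)
    · rw [extendMatrix_of_notMem _ hT, if_neg]
      rintro rfl
      exact hij ((adjoin S).le_refl i)
  · filter_upwards [Filter.eventually_ge_atTop ({i, j} : Finset Λ)] with T hT
    have hT' : ({i, j} : Finset Λ) ⊆ H T := hT.trans (Finset.subset_union_right.trans (hH T))
    exact extendMatrix_of_mem (block u.1 (H T)) ⟨i, hT' (by simp)⟩ ⟨j, hT' (by simp)⟩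

end Diagonal

end AU

/-! ### The largest closed normal subgroup and the simple quotient. -/

section Main

variable {Λ F : Type*} [Preorder Λ] [ZLike Λ] [Infinite Λ] [Field F]

theorem scalarSubgroup_ne_top : scalarSubgroup Λ F ≠ ⊤ := by
  intro H
  obtain ⟨i, j, hij⟩ := exists_pair_ne Λ
  have hmem : AU.tv (Finsupp.single i (1 : F)) j (Finsupp.single_eq_of_ne' hij) ∈
      scalarSubgroup Λ F := H ▸ Subgroup.mem_top _
  have := hmem.1 i j hij
  rw [AU.tv_apply] at this
  simp [hij] at this

variable [TopologicalSpace F] [DiscreteTopology F]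

theorem isGreatest_scalarSubgroup :
    IsGreatest {N : Subgroup (AU Λ F) | N ≠ ⊤ ∧ N.Normal ∧ IsClosed (N : Set (AU Λ F))}
      (scalarSubgroup Λ F) := by
  refine ⟨⟨scalarSubgroup_ne_top, inferInstance, AU.isClosed_scalarSubgroup⟩, ?_⟩
  rintro N ⟨hne, hN, hclosed⟩ g hg
  by_contra hgZ
  exact hne (AU.eq_top_of_single_mem
    (fun _ _ hij c => AU.single_mem_of_not_scalar hg hgZ hij c) hclosed)

theorem isTopologicallySimple_quotient :
    IsTopologicallySimple (AU Λ F ⧸ scalarSubgroup Λ F) where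
  nontrivial := QuotientGroup.nontrivial_iff.2 scalarSubgroup_ne_top
  eq_bot_or_eq_top M hM hclosed := by
    have hmk := QuotientGroup.mk'_surjective (scalarSubgroup Λ F)
    -- The preimage of `M` is closed and normal, so it is the whole group or consists of scalar
    -- matrices.
    by_cases htop : M.comap (QuotientGroup.mk' (scalarSubgroup Λ F)) = ⊤
    · right
      rw [← Subgroup.map_comap_eq_self_of_surjective hmk M, htop,
        Subgroup.map_top_of_surjective _ hmk]
    · left
      have hle := isGreatest_scalarSubgroup.2
        ⟨htop, hM.comap _, hclosed.preimage QuotientGroup.continuous_mk⟩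
      rw [← Subgroup.map_comap_eq_self_of_surjective hmk M, eq_bot_iff]
      rw [Subgroup.map_le_iff_le_comap, MonoidHom.comap_bot, QuotientGroup.ker_mk']
      exact hle

end Main

end Density

theorem mainTheorem1 {Λ F : Type*} [Preorder Λ] [ZLike Λ] [Infinite Λ]
    [Field F] [Finite F] [TopologicalSpace F] [DiscreteTopology F] :
    (IsTopologicalGroup (AU Λ F) ∧ TotallyDisconnectedSpace (AU Λ F) ∧
      LocallyCompactSpace (AU Λ F)) ∧
    IsGreatest {N : Subgroup (AU Λ F) | N ≠ ⊤ ∧ N.Normal ∧ IsClosed (N : Set (AU Λ F))}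
      (scalarSubgroup Λ F) ∧
    IsTopologicallySimple (AU Λ F ⧸ scalarSubgroup Λ F) :=
  ⟨⟨inferInstance, inferInstance, inferInstance⟩, isGreatest_scalarSubgroup,
    isTopologicallySimple_quotient⟩
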